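/- The game of abelian groups is the following two-player impartial game under the normal play rule. Positions are finitely generated abelian groups; a move from $A$ consists of choosing an element $a \in A$ with $a \neq 0$ and replacing $A$ by the quotient $A/\langle a\rangle$, where $\langle a\rangle$ is the cyclic subgroup generated by $a$. Every play of this game ends after finitely many moves. The nimber (Sprague–Grundy value) $\alpha(A)$ is the ordinal number defined recursively by $$\alpha(A) = \min\{\beta \text{ an ordinal} : \beta \neq \alpha(A/\langle a\rangle) \text{ for all } a \in A,\ a \neq 0\}.$$ For an integer $n \geq 1$ let $\Omega(n)$ be the number of prime factors of $n$ counted with multiplicity, and let $\omega$ be the first infinite ordinal. **Theorem.** For every integer $n \geq 1$ one has $\alpha(\mathbb{Z}/n) = \Omega(n)$. Moreover $\alpha(\mathbb{Z}) = \omega$, and for every integer $n \geq 1$ one has $\alpha(\mathbb{Z}/n \oplus \mathbb{Z}) = \omega + \Omega(n)$. -/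

import Mathlib

universe u

instance ZMod.addGroupFG (n : ℕ) : AddGroup.FG (ZMod n) :=
  Module.Finite.iff_addGroup_fg.mp
    (Module.Finite.of_surjective (Int.castAddHom (ZMod n)).toIntLinearMap ZMod.intCast_surjective)

instance ZMod.prodIntAddGroupFG (n : ℕ) : AddGroup.FG (ZMod n × ℤ) :=
  have : Module.Finite ℤ (ZMod n) := Module.Finite.iff_addGroup_fg.mpr inferInstance
  Module.Finite.iff_addGroup_fg.mp inferInstance

/-- The minimal excluded ordinal: the least ordinal number not contained in `S`.  It is used below
only for sets indexed by a type in the universe `u`, whose complement is never empty. -/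
noncomputable def Ordinal.minExcluded (S : Set Ordinal.{u}) : Ordinal.{u} := sInf Sᶜ

/-- A position in the game of abelian groups: a finitely generated abelian group. -/
structure FGAbGroup : Type (u + 1) where
  /-- the underlying type -/
  carrier : Type u
  [addCommGroup : AddCommGroup carrier]
  [fg : AddGroup.FG carrier]

namespace FGAbGroup

attribute [instance] addCommGroup fg

/-- The move picking `a`: it replaces the group `A` by the quotient `A / ⟨a⟩` by the cyclic
subgroup generated by `a`. -/
def move (A : FGAbGroup.{u}) (a : A.carrier) : FGAbGroup.{u} where
  carrier := A.carrier ⧸ AddSubgroup.zmultiples a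

/-- `IsOption B A`: the position `B` is an option of `A`, i.e. `B` is `A / ⟨a⟩` for some nonzero
element `a` of `A`. -/
def IsOption (B A : FGAbGroup.{u}) : Prop := ∃ a : A.carrier, a ≠ 0 ∧ B = A.move a

theorem acc_of_surjective {A : Type u} [AddCommGroup A] [AddGroup.FG A] (H : Submodule ℤ A) :
    ∀ (B : FGAbGroup.{u}) (f : A →ₗ[ℤ] B.carrier), Function.Surjective f →
      LinearMap.ker f = H → Acc IsOption B := by
  have : Module.Finite ℤ A := Module.Finite.iff_addGroup_fg.mpr inferInstance
  have : IsNoetherian ℤ A := isNoetherian_of_isNoetherianRing_of_finite ℤ A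
  induction H using (wellFounded_gt (α := Submodule ℤ A)).induction with
  | _ H ih =>
    intro B f hf hH
    refine ⟨_, ?_⟩
    rintro _ ⟨b, hb, rfl⟩
    let q : B.carrier →ₗ[ℤ] (B.move b).carrier :=
      (QuotientAddGroup.mk' (AddSubgroup.zmultiples b)).toIntLinearMap
    have hq : Function.Surjective q :=
      QuotientAddGroup.mk'_surjective (AddSubgroup.zmultiples b)
    have hqb : q b = 0 :=
      (QuotientAddGroup.eq_zero_iff b).mpr (AddSubgroup.mem_zmultiples b)
    refine ih _ ?_ (B.move b) (q.comp f) (hq.comp hf) rfl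
    obtain ⟨a, rfl⟩ := hf b
    refine lt_of_le_of_ne (fun x hx => ?_) (fun h => hb ?_)
    · rw [← hH, LinearMap.mem_ker] at hx
      simp [hx]
    · have ha : a ∈ LinearMap.ker (q.comp f) := hqb
      rw [← h, ← hH] at ha
      exact ha

/-- The ending condition: the game of a finitely generated abelian group ends after finitely many
moves. -/
theorem wellFounded_isOption : WellFounded IsOption.{u} :=
  ⟨fun A => acc_of_surjective (A := A.carrier) _ A LinearMap.id Function.surjective_id rfl⟩

/-- The nimber (Sprague-Grundy value) of a position, by recursion on options. -/
noncomputable def grundyValue : FGAbGroup.{u} → Ordinal.{u} :=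
  wellFounded_isOption.fix fun A value =>
    Ordinal.minExcluded
      {o | ∃ (a : A.carrier) (ha : a ≠ 0), value (A.move a) ⟨a, ha, rfl⟩ = o}

end FGAbGroup

/-- The nimber of a finitely generated abelian group `A` in the game of abelian groups. -/
noncomputable def nimber (A : Type u) [AddCommGroup A] [AddGroup.FG A] : Ordinal.{u} :=
  FGAbGroup.grundyValue ⟨A⟩

/-- The nimber of `A` is the least ordinal which is not the nimber of any quotient `A / ⟨a⟩` with
`a ≠ 0`. -/
theorem nimber_eq (A : Type u) [AddCommGroup A] [AddGroup.FG A] :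
    nimber A = Ordinal.minExcluded
      {o | ∃ a : A, a ≠ 0 ∧ nimber (A ⧸ AddSubgroup.zmultiples a) = o} := by
  unfold nimber
  conv_lhs => rw [FGAbGroup.grundyValue, WellFounded.fix_eq]
  congr 1
  ext o
  simp only [exists_prop]
  rfl

/-!
The nimber of an abelian group is an isomorphism invariant (`nimber_congr`), so only the isomorphism
types of the options matter.

For a finite cyclic group `C` the options are the cyclic groups whose order is a proper divisor of
the order of `C`. Since `Ω` drops strictly along proper divisors, and every number up to
`Ω (Nat.card C)` is `Ω` of some divisor, the nimber is `Ω (Nat.card C)` by induction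
(`nimber_eq_cardFactors_card`).

The options of `G = ZMod n × ℤ` by an element `(a, 0)` are the groups `ZMod d × ℤ` with `d` a proper
divisor of `n`. They contribute by induction the values `ω + j` with `j < Ω n`. The options by
`(a, m)` with `m ≠ 0` are finite groups, whose nimbers are finite because they have finitely many
options. So the nimber of `G` is `ω + Ω n`, provided that every natural number `k` is the nimber of
a finite option of `G` (`exists_nimber_quotient_prod_int_eq_natCast`).

This is proved by induction on `k`. Let `g i`, for `i < k`, give finite options of nimber `i`, and
suppose that no finite option has nimber `k`. For a suitable common multiple `N` of `n` and the
second coordinates of the `g i`, the group `H = G / ⟨(0, N)⟩` has all the `G / ⟨g i⟩` among its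
options. Conversely every option of `H` is isomorphic to a finite option of `G`
(`exists_nimber_quotient_eq_nimber_quotient_quotient`), hence does not have nimber `k`. Therefore `H`
itself has nimber `k`; but `H` is a finite option of `G`, a contradiction.

For the converse just used, an option `A` of `H` is generated by the images `u`, `v` of `(1, 0)` and
`(0, 1)`. As `n ∣ N` and only one further relation is imposed, `n` divides the exponent of `A`
(`Int.dvd_of_rank_one`). This allows to replace `u` by some `u + c • v` of order exactly `n`
(`exists_addOrderOf_add_nsmul_eq`). Then `ZMod n` embeds into `A`, so the kernel of the resulting
surjection `ZMod n × ℤ → A` meets the torsion trivially, embeds into `ℤ`, and is cyclic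
(`exists_nimber_quotient_prod_int_eq`).

The case of `ℤ` is that of `ZMod 1 × ℤ`.
-/

/-! ### Nimbers of isomorphic groups and of quotients -/

theorem nimber_eq_of_forall {A : Type u} [AddCommGroup A] [AddGroup.FG A] {β : Ordinal.{u}}
    (hne : ∀ a : A, a ≠ 0 → nimber (A ⧸ AddSubgroup.zmultiples a) ≠ β)
    (hex : ∀ γ < β, ∃ a : A, a ≠ 0 ∧ nimber (A ⧸ AddSubgroup.zmultiples a) = γ) :
    nimber A = β := by
  rw [nimber_eq, Ordinal.minExcluded]
  refine IsLeast.csInf_eq ⟨fun ⟨a, ha, h⟩ => hne a ha h, fun γ hγ => ?_⟩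
  by_contra! h
  exact hγ (hex γ h)

theorem FGAbGroup.grundyValue_congr (A : FGAbGroup.{u}) :
    ∀ (B : FGAbGroup.{u}), (A.carrier ≃+ B.carrier) → A.grundyValue = B.grundyValue := by
  induction A using FGAbGroup.wellFounded_isOption.induction with
  | _ A ih =>
    intro B e
    change nimber A.carrier = nimber B.carrier
    rw [nimber_eq, nimber_eq]
    have key (a : A.carrier) (ha : a ≠ 0) :
        nimber (A.carrier ⧸ AddSubgroup.zmultiples a) =
          nimber (B.carrier ⧸ AddSubgroup.zmultiples (e a)) :=
      ih (A.move a) ⟨a, ha, rfl⟩ (B.move (e a))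
        (QuotientAddGroup.congr _ _ e (AddMonoidHom.map_zmultiples e.toAddMonoidHom a))
    congr 1
    ext o
    constructor
    · rintro ⟨a, ha, rfl⟩
      exact ⟨e a, by simpa using ha, (key a ha).symm⟩
    · rintro ⟨b, hb, rfl⟩
      obtain ⟨a, rfl⟩ := e.surjective b
      have ha : a ≠ 0 := by simpa using hb
      exact ⟨a, ha, key a ha⟩

theorem nimber_congr {A B : Type u} [AddCommGroup A] [AddGroup.FG A] [AddCommGroup B]
    [AddGroup.FG B] (e : A ≃+ B) : nimber A = nimber B :=
  FGAbGroup.grundyValue_congr ⟨A⟩ ⟨B⟩ e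

theorem nimber_quotient_zmultiples_eq {A B : Type u} [AddCommGroup A] [AddGroup.FG A]
    [AddCommGroup B] [AddGroup.FG B] (f : A →+ B) (hf : Function.Surjective f) (a : A)
    (hker : ∀ x, f x = 0 ↔ x ∈ AddSubgroup.zmultiples a) :
    nimber (A ⧸ AddSubgroup.zmultiples a) = nimber B := by
  have h : AddSubgroup.zmultiples a = f.ker := by
    ext x
    rw [← hker, AddMonoidHom.mem_ker]
  exact nimber_congr ((QuotientAddGroup.quotientAddEquivOfEq h).trans
    (QuotientAddGroup.quotientKerEquivOfSurjective f hf))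

/-- An option `A / ⟨g⟩` of `A` remains an option after the move `z`, if `z` is a multiple of `g`. -/
theorem nimber_quotient_quotient_mk {A : Type u} [AddCommGroup A] [AddGroup.FG A] {z g : A}
    (hz : z ∈ AddSubgroup.zmultiples g) :
    nimber ((A ⧸ AddSubgroup.zmultiples z) ⧸
      AddSubgroup.zmultiples (QuotientAddGroup.mk g : A ⧸ AddSubgroup.zmultiples z)) =
      nimber (A ⧸ AddSubgroup.zmultiples g) := by
  have hzg : AddSubgroup.zmultiples z ≤ AddSubgroup.zmultiples g :=
    AddSubgroup.zmultiples_le.mpr hz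
  refine nimber_quotient_zmultiples_eq
    (QuotientAddGroup.lift (AddSubgroup.zmultiples z)
      (QuotientAddGroup.mk' (AddSubgroup.zmultiples g))
      fun x hx => (QuotientAddGroup.eq_zero_iff x).mpr (hzg hx))
    (fun x => ?_) _ fun x => ?_
  · obtain ⟨y, rfl⟩ := QuotientAddGroup.mk_surjective x
    exact ⟨QuotientAddGroup.mk y, rfl⟩
  · obtain ⟨x, rfl⟩ := QuotientAddGroup.mk_surjective x
    change (QuotientAddGroup.mk x : A ⧸ AddSubgroup.zmultiples g) = 0 ↔ _
    rw [QuotientAddGroup.eq_zero_iff]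
    constructor
    · intro h
      obtain ⟨s, rfl⟩ := AddSubgroup.mem_zmultiples_iff.mp h
      exact ⟨s, rfl⟩
    · rintro ⟨s, hs⟩
      have hs' : (QuotientAddGroup.mk (s • g) : A ⧸ AddSubgroup.zmultiples z) =
        QuotientAddGroup.mk x := hs
      simpa using (AddSubgroup.zmultiples g).sub_mem (AddSubgroup.zsmul_mem_zmultiples g s)
        (hzg (QuotientAddGroup.eq_iff_sub_mem.mp hs'))

/-! ### Finite groups -/

theorem AddSubgroup.card_quotient_zmultiples_mul_addOrderOf {A : Type u} [AddCommGroup A] (a : A) :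
    Nat.card (A ⧸ AddSubgroup.zmultiples a) * addOrderOf a = Nat.card A := by
  rw [← Nat.card_zmultiples, ← AddSubgroup.card_eq_card_quotient_mul_card_addSubgroup]

theorem AddSubgroup.card_quotient_zmultiples_lt {A : Type u} [AddCommGroup A] [Finite A] {a : A}
    (ha : a ≠ 0) : Nat.card (A ⧸ AddSubgroup.zmultiples a) < Nat.card A := by
  rw [← card_quotient_zmultiples_mul_addOrderOf a]
  have h0 : 0 < addOrderOf a := addOrderOf_pos a
  have h1 : addOrderOf a ≠ 1 := by simpa using ha
  have : 0 < Nat.card (A ⧸ AddSubgroup.zmultiples a) := Nat.card_pos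
  nlinarith [show 2 ≤ addOrderOf a by omega]

theorem nimber_lt_omega0_of_finite (A : Type u) [AddCommGroup A] [AddGroup.FG A] [Finite A] :
    nimber A < Ordinal.omega0.{u} := by
  induction h : Nat.card A using Nat.strong_induction_on generalizing A with
  | _ n ih =>
    subst h
    have key (a : A) (ha : a ≠ 0) : nimber (A ⧸ AddSubgroup.zmultiples a) < Ordinal.omega0.{u} :=
      ih _ (AddSubgroup.card_quotient_zmultiples_lt ha) _ rfl
    have hfin : {o | ∃ a : A, a ≠ 0 ∧ nimber (A ⧸ AddSubgroup.zmultiples a) = o}.Finite := by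
      refine (Set.finite_range fun a : A => nimber (A ⧸ AddSubgroup.zmultiples a)).subset ?_
      rintro o ⟨a, -, rfl⟩
      exact ⟨a, rfl⟩
    -- a finite set of ordinals omits some natural number
    obtain ⟨o, ⟨k, rfl⟩, hk⟩ :=
      (Set.infinite_range_of_injective (Nat.cast_injective (R := Ordinal.{u}))).exists_notMem_finite
        hfin
    rw [nimber_eq]
    exact (csInf_le' hk).trans_lt (Ordinal.natCast_lt_omega0 k)

/-! ### Finite cyclic groups -/

open ArithmeticFunction in
theorem Nat.exists_dvd_cardFactors_eq {n j : ℕ} (hn : n ≠ 0) (hj : j ≤ cardFactors n) :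
    ∃ d, d ∣ n ∧ cardFactors d = j := by
  induction n using Nat.recOnMul generalizing j with
  | zero => exact absurd rfl hn
  | one => exact ⟨1, dvd_rfl, by simp_all⟩
  | prime p hp =>
    rw [cardFactors_apply_prime hp] at hj
    interval_cases j
    · exact ⟨1, one_dvd _, by simp⟩
    · exact ⟨p, dvd_rfl, cardFactors_apply_prime hp⟩
  | mul a b iha ihb =>
    obtain ⟨ha, hb⟩ := mul_ne_zero_iff.mp hn
    rw [cardFactors_mul ha hb] at hj
    rcases le_total j (cardFactors a) with h | h
    · obtain ⟨d, hd, h⟩ := iha ha h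
      exact ⟨d, hd.mul_right b, h⟩
    · obtain ⟨d, hd, h'⟩ := ihb hb (show j - cardFactors a ≤ cardFactors b by omega)
      refine ⟨a * d, mul_dvd_mul_left a hd, ?_⟩
      rw [cardFactors_mul ha (ne_zero_of_dvd_ne_zero hb hd)]
      omega

open ArithmeticFunction in
theorem cardFactors_card_quotient_zmultiples_lt {A : Type u} [AddCommGroup A] [Finite A] {a : A}
    (ha : a ≠ 0) :
    cardFactors (Nat.card (A ⧸ AddSubgroup.zmultiples a)) < cardFactors (Nat.card A) := by
  rw [← AddSubgroup.card_quotient_zmultiples_mul_addOrderOf a,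
    cardFactors_mul Nat.card_pos.ne' (addOrderOf_pos a).ne']
  have : 0 < cardFactors (addOrderOf a) :=
    Nat.pos_of_ne_zero fun h => by
      rcases cardFactors_eq_zero_iff_eq_zero_or_one.mp h with h | h
      · exact (addOrderOf_pos a).ne' h
      · exact ha (AddMonoid.addOrderOf_eq_one_iff.mp h)
  omega

open ArithmeticFunction in
theorem exists_cardFactors_card_quotient_zmultiples_eq {A : Type u} [AddCommGroup A] [Finite A]
    [IsAddCyclic A] {j : ℕ} (hj : j < cardFactors (Nat.card A)) :
    ∃ a : A, a ≠ 0 ∧ cardFactors (Nat.card (A ⧸ AddSubgroup.zmultiples a)) = j := by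
  obtain ⟨d, hd, rfl⟩ := Nat.exists_dvd_cardFactors_eq Nat.card_pos.ne' hj.le
  obtain ⟨g, hg⟩ := IsAddCyclic.exists_ofOrder_eq_natCard (α := A)
  have hd0 : d ≠ 0 := ne_zero_of_dvd_ne_zero Nat.card_pos.ne' hd
  have hord : addOrderOf (d • g) = Nat.card A / d := by
    rw [addOrderOf_nsmul_of_dvd hd0 (hg ▸ hd), hg]
  have hcard : Nat.card (A ⧸ AddSubgroup.zmultiples (d • g)) = d := by
    have h := AddSubgroup.card_quotient_zmultiples_mul_addOrderOf (d • g)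
    rw [hord] at h
    have h' := Nat.mul_div_cancel' hd
    have hpos : 0 < Nat.card A / d := Nat.div_pos (Nat.le_of_dvd Nat.card_pos hd) (by omega)
    exact Nat.eq_of_mul_eq_mul_right hpos (h.trans h'.symm)
  refine ⟨d • g, fun h => hj.ne ?_, by rw [hcard]⟩
  rw [h, addOrderOf_zero] at hord
  rw [← Nat.mul_div_cancel' hd, ← hord, mul_one]

open ArithmeticFunction in
theorem nimber_eq_cardFactors_card (A : Type u) [AddCommGroup A] [AddGroup.FG A] [Finite A]
    [IsAddCyclic A] : nimber A = (cardFactors (Nat.card A) : Ordinal.{u}) := by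
  induction h : Nat.card A using Nat.strong_induction_on generalizing A with
  | _ n ih =>
    subst h
    have key (a : A) (ha : a ≠ 0) : nimber (A ⧸ AddSubgroup.zmultiples a) =
        (cardFactors (Nat.card (A ⧸ AddSubgroup.zmultiples a)) : Ordinal.{u}) :=
      have : IsAddCyclic (A ⧸ AddSubgroup.zmultiples a) :=
        isAddCyclic_of_surjective (QuotientAddGroup.mk' _) (QuotientAddGroup.mk'_surjective _)
      ih _ (AddSubgroup.card_quotient_zmultiples_lt ha) _ rfl
    refine nimber_eq_of_forall (fun a ha => ?_) fun γ hγ => ?_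
    · rw [key a ha, Ne, Nat.cast_inj]
      exact (cardFactors_card_quotient_zmultiples_lt ha).ne
    · obtain ⟨j, rfl⟩ := Ordinal.lt_omega0.mp (hγ.trans (Ordinal.natCast_lt_omega0 _))
      obtain ⟨a, ha, h⟩ := exists_cardFactors_card_quotient_zmultiples_eq (Nat.cast_lt.mp hγ)
      exact ⟨a, ha, by rw [key a ha, h]⟩

/-! ### Groups generated by two elements -/

theorem Nat.eq_of_dvd_lcm_of_gcd_dvd {n d f : ℕ} (hn : n ≠ 0) (hdn : d ∣ n) (hlcm : n ∣ d.lcm f)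
    (hgcd : n.gcd f ∣ d) : d = n := by
  obtain ⟨k, rfl⟩ := hdn
  have hd : 0 < d := Nat.pos_of_ne_zero (left_ne_zero_of_mul hn)
  have hg : 0 < d.gcd f := Nat.gcd_pos_of_pos_left f hd
  have h1 : d.gcd f * k ∣ f := by
    have h := mul_dvd_mul_left (d.gcd f) hlcm
    rw [Nat.gcd_mul_lcm, mul_left_comm] at h
    exact Nat.dvd_of_mul_dvd_mul_left hd h
  have h2 : d.gcd f * k ∣ d * k := mul_dvd_mul_right (Nat.gcd_dvd_left d f) k
  have h3 : (d * k).gcd f ∣ d.gcd f := Nat.dvd_gcd hgcd (Nat.gcd_dvd_right _ _)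
  have h4 : d.gcd f * k ∣ d.gcd f * 1 := by simpa using (Nat.dvd_gcd h2 h1).trans h3
  rw [Nat.dvd_one.mp (Nat.dvd_of_mul_dvd_mul_left hg h4), mul_one]

/-- If `n` kills `u` and divides the exponent of the group generated by `u` and `v`, a multiple of
`v` can be added to `u` so that the order becomes exactly `n`. Locally at each prime `p` dividing
`n`, either the order of `u` already has the full power of `p`, and the summand is made to lose a
factor `p`, or the order of the summand supplies it. -/
theorem exists_addOrderOf_add_nsmul_eq {A : Type*} [AddCommGroup A] {n : ℕ} (hn : n ≠ 0) {u v : A}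
    (hu : n • u = 0) (hv : IsOfFinAddOrder v)
    (hexp : ∀ d : ℕ, d • u = 0 → d • v = 0 → n ∣ d) :
    ∃ c : ℕ, addOrderOf (u + c • v) = n := by
  set e := addOrderOf u
  set f := addOrderOf v
  have hen : e ∣ n := addOrderOf_dvd_of_nsmul_eq_zero hu
  have hlcm : n ∣ e.lcm f := hexp _ (addOrderOf_dvd_iff_nsmul_eq_zero.mp (Nat.dvd_lcm_left e f))
    (addOrderOf_dvd_iff_nsmul_eq_zero.mp (Nat.dvd_lcm_right e f))
  -- `t • v` has order `n.gcd f`, the largest order of a multiple of `v` killed by `n`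
  obtain ⟨t, ht⟩ := Nat.gcd_dvd_right n f
  have ht0 : 0 < t := Nat.pos_of_ne_zero fun h =>
    hv.addOrderOf_pos.ne' (by rw [h, mul_zero] at ht; exact ht)
  have hsmul (k : ℕ) : k • t • v = 0 ↔ n.gcd f ∣ k := by
    rw [← mul_nsmul', ← addOrderOf_dvd_iff_nsmul_eq_zero]
    change f ∣ _ ↔ _
    conv_lhs => rw [ht]
    exact Nat.mul_dvd_mul_iff_right ht0
  have hw : n • t • v = 0 := (hsmul n).mpr (Nat.gcd_dvd_left n f)
  set c := ∏ p ∈ n.primeFactors with ¬ p ∣ n / e, p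
  refine ⟨c * t, addOrderOf_eq_of_nsmul_and_div_prime_nsmul (Nat.pos_of_ne_zero hn) ?_ ?_⟩
  · rw [nsmul_add, hu, mul_nsmul', nsmul_left_comm, hw, nsmul_zero, add_zero]
  · intro p hp hpn h0
    obtain ⟨k, rfl⟩ := hpn
    have hdiv : p * k / p = k := Nat.mul_div_cancel_left k hp.pos
    have hk : k ≠ 0 := right_ne_zero_of_mul hn
    rw [hdiv, nsmul_add, mul_nsmul', nsmul_left_comm] at h0
    by_cases hpe : p ∣ p * k / e
    · -- here the `p`-part of the order of `u` is too small, so that of `t • v` must be full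
      have hek : e ∣ k := by
        obtain ⟨l, hl⟩ := hpe
        have := Nat.mul_div_cancel' hen
        rw [hl, mul_left_comm] at this
        exact ⟨l, (Nat.eq_of_mul_eq_mul_left hp.pos this).symm⟩
      rw [addOrderOf_dvd_iff_nsmul_eq_zero.mp hek, zero_add] at h0
      have hcop : p.Coprime c := by
        refine Nat.Coprime.prod_right fun q hq => ?_
        rw [Finset.mem_filter] at hq
        exact (Nat.coprime_primes hp (Nat.prime_of_mem_primeFactors hq.1)).mpr
          fun h => hq.2 (h ▸ hpe)
      have h1 : addOrderOf (k • t • v) ∣ p.gcd c := Nat.dvd_gcd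
        (addOrderOf_dvd_of_nsmul_eq_zero (by rw [← mul_nsmul', hw]))
        (addOrderOf_dvd_of_nsmul_eq_zero h0)
      rw [hcop.gcd_eq_one, Nat.dvd_one, AddMonoid.addOrderOf_eq_one_iff, hsmul] at h1
      have h2 := Nat.eq_of_dvd_lcm_of_gcd_dvd hn (Dvd.intro_left p rfl)
        (hlcm.trans (lcm_dvd_lcm hek dvd_rfl)) h1
      have := hp.two_le
      nlinarith [Nat.pos_of_ne_zero hk]
    · -- here `p` divides `c`, and the `p`-part of the order of `u` is already full
      have hpc : p ∣ c := Finset.dvd_prod_of_mem _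
        (Finset.mem_filter.mpr ⟨Nat.mem_primeFactors.mpr ⟨hp, Dvd.intro k rfl, hn⟩, hpe⟩)
      obtain ⟨c', hc'⟩ := hpc
      rw [hc', mul_comm p c', mul_nsmul', ← mul_nsmul' _ p k, hw, nsmul_zero, add_zero]
        at h0
      obtain ⟨l, hl⟩ := addOrderOf_dvd_of_nsmul_eq_zero h0
      refine hpe ⟨l, ?_⟩
      change k = e * l at hl
      have he : 0 < e := Nat.pos_of_ne_zero fun h => hk (by simp [hl, h])
      rw [hl, mul_left_comm, Nat.mul_div_cancel_left _ he]

/-- If the scalar matrix `d • 1` of size two is congruent modulo `n` to the product of the column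
`(x, y)` and the row `(a, m)`, then `n ∣ d`. After dividing by the gcd of `n` and `d`, taking
determinants gives `n ∣ d ^ 2` with `n` and `d` coprime. -/
theorem Int.dvd_of_rank_one {n d a m x y : ℤ} (hn : n ≠ 0)
    (h₁ : n ∣ x * a - d) (h₂ : n ∣ x * m) (h₃ : n ∣ y * a) (h₄ : n ∣ y * m - d) : n ∣ d := by
  obtain ⟨i, hi⟩ := h₁
  obtain ⟨j, hj⟩ := h₂
  obtain ⟨k, hk⟩ := h₃
  obtain ⟨l, hl⟩ := h₄
  have hdet : (d + n * i) * (d + n * l) = (n * j) * (n * k) := by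
    rw [← hi, ← hj, ← hk, ← hl]
    ring
  have hg : (n.gcd d : ℤ) ≠ 0 := by
    simpa [Int.gcd_eq_zero_iff] using fun h => absurd h hn
  obtain ⟨n', d', hcop, hn', hd'⟩ := Int.exists_gcd_one (m := n) (n := d) (Int.gcd_pos_of_ne_zero_left _ hn)
  generalize (n.gcd d : ℤ) = g at *
  subst hn' hd'
  have hdet' : (d' + n' * i) * (d' + n' * l) = (n' * j) * (n' * k) :=
    mul_left_cancel₀ (mul_ne_zero hg hg) (by linear_combination hdet)
  have h : n' ∣ d' * d' := ⟨n' * j * k - d' * l - d' * i - n' * i * l, by linear_combination hdet'⟩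
  have hcop' : IsCoprime n' d' := Int.isCoprime_iff_gcd_eq_one.mpr hcop
  exact mul_dvd_mul_right (hcop'.dvd_of_dvd_mul_left h) g

/-- A torsion group generated by two elements, one of which has order `n`, is isomorphic to an option
of `ZMod n × ℤ`. -/
theorem exists_nimber_quotient_prod_int_eq {n N : ℕ} (hN : N ≠ 0) {A : Type}
    [AddCommGroup A] [AddGroup.FG A] {u v : A} (hu : addOrderOf u = n) (hv : N • v = 0)
    (hgen : ∀ x : A, ∃ i j : ℤ, i • u + j • v = x) :
    ∃ g : ZMod n × ℤ, g.2 ≠ 0 ∧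
      nimber ((ZMod n × ℤ) ⧸ AddSubgroup.zmultiples g) = nimber A := by
  let φ : ZMod n →+ A := ZMod.lift n ⟨zmultiplesHom A u, by simp [← hu, addOrderOf_nsmul_eq_zero]⟩
  have hφ (i : ℤ) : φ i = i • u := by simp [φ]
  have hφinj (x : ZMod n) (hx : φ x = 0) : x = 0 := by
    obtain ⟨i, rfl⟩ := ZMod.intCast_surjective x
    rw [hφ, ← addOrderOf_dvd_iff_zsmul_eq_zero, hu] at hx
    exact (ZMod.intCast_zmod_eq_zero_iff_dvd i n).mpr hx
  let F : ZMod n × ℤ →+ A := φ.coprod (zmultiplesHom A v)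
  have hF (x : ZMod n) (j : ℤ) : F (x, j) = φ x + j • v := by simp [F]
  have hsurj : Function.Surjective F := fun x => by
    obtain ⟨i, j, rfl⟩ := hgen x
    exact ⟨((i : ZMod n), j), by rw [hF, hφ]⟩
  -- the second projection embeds the kernel into `ℤ`, because `φ` is injective
  have hinj (x y : ZMod n × ℤ) (hx : F x = 0) (hy : F y = 0) (h : x.2 = y.2) : x = y := by
    have h' : F (x - y) = 0 := by rw [map_sub, hx, hy, sub_zero]
    have e : x - y = (x.1 - y.1, 0) := Prod.ext rfl (by simp [h])
    rw [e, hF, zero_smul, add_zero] at h'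
    exact Prod.ext (sub_eq_zero.mp (hφinj _ h')) h
  obtain ⟨m, hm⟩ := Int.subgroup_cyclic (F.ker.map (AddMonoidHom.snd (ZMod n) ℤ))
  rw [← AddSubgroup.zmultiples_eq_closure] at hm
  obtain ⟨g, hg, hgm⟩ : m ∈ F.ker.map (AddMonoidHom.snd (ZMod n) ℤ) :=
    hm ▸ AddSubgroup.mem_zmultiples m
  have hgm' : g.2 = m := hgm
  have hg' : F g = 0 := hg
  have hker (x : ZMod n × ℤ) : F x = 0 ↔ x ∈ AddSubgroup.zmultiples g := by
    constructor
    · intro hx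
      have hx' : x.2 ∈ F.ker.map (AddMonoidHom.snd (ZMod n) ℤ) := ⟨x, hx, rfl⟩
      rw [hm] at hx'
      obtain ⟨k, hk⟩ := AddSubgroup.mem_zmultiples_iff.mp hx'
      refine AddSubgroup.mem_zmultiples_iff.mpr ⟨k, hinj _ _ ?_ hx ?_⟩
      · rw [map_zsmul, hg', smul_zero]
      · rw [Prod.smul_snd, hgm', hk]
    · intro hx
      obtain ⟨k, rfl⟩ := AddSubgroup.mem_zmultiples_iff.mp hx
      rw [map_zsmul, hg', smul_zero]
  -- `(0, N)` lies in the kernel, which forces the generator `g` to leave the torsion subgroup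
  refine ⟨g, fun h0 => hN ?_, nimber_quotient_zmultiples_eq F hsurj g hker⟩
  obtain ⟨k, hk⟩ := AddSubgroup.mem_zmultiples_iff.mp
    ((hker (0, (N : ℤ))).mp (by rw [hF, map_zero, zero_add, natCast_zsmul, hv]))
  have := congrArg Prod.snd hk
  rw [Prod.smul_snd, h0, smul_zero] at this
  exact Int.natCast_eq_zero.mp this.symm

/-- For `n ∣ N`, every quotient of `(ZMod n × ℤ) / ⟨(0, N)⟩` by a cyclic subgroup is isomorphic to a
finite option of `ZMod n × ℤ`. -/
theorem exists_nimber_quotient_eq_nimber_quotient_quotient {n N : ℕ} (hn : n ≠ 0) (hN : N ≠ 0)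
    (hnN : n ∣ N)
    (h : (ZMod n × ℤ) ⧸ AddSubgroup.zmultiples ((0, (N : ℤ)) : ZMod n × ℤ)) :
    ∃ g : ZMod n × ℤ, g.2 ≠ 0 ∧ nimber ((ZMod n × ℤ) ⧸ AddSubgroup.zmultiples g) =
      nimber (((ZMod n × ℤ) ⧸ AddSubgroup.zmultiples ((0, (N : ℤ)) : ZMod n × ℤ)) ⧸
        AddSubgroup.zmultiples h) := by
  obtain ⟨⟨a', m⟩, rfl⟩ := QuotientAddGroup.mk_surjective h
  obtain ⟨a, rfl⟩ := ZMod.intCast_surjective a'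
  set z : ZMod n × ℤ := (0, (N : ℤ)) with hz
  set h : (ZMod n × ℤ) ⧸ AddSubgroup.zmultiples z :=
    QuotientAddGroup.mk ((a : ZMod n), m)
  let π : ZMod n × ℤ →+ (((ZMod n × ℤ) ⧸ AddSubgroup.zmultiples z) ⧸ AddSubgroup.zmultiples h) :=
    (QuotientAddGroup.mk' _).comp (QuotientAddGroup.mk' _)
  have hπ : Function.Surjective π :=
    (QuotientAddGroup.mk'_surjective _).comp (QuotientAddGroup.mk'_surjective _)
  -- modulo `n`, the relations of the quotient are the multiples of the single row `(a, m)`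
  have hπ0 (i j : ℤ) (hx : π ((i : ZMod n), j) = 0) :
      ∃ x : ℤ, (n : ℤ) ∣ x * a - i ∧ (n : ℤ) ∣ x * m - j := by
    obtain ⟨x, hx⟩ := AddSubgroup.mem_zmultiples_iff.mp ((QuotientAddGroup.eq_zero_iff _).mp hx)
    have hx' : (QuotientAddGroup.mk (x • ((a : ZMod n), m)) :
        (ZMod n × ℤ) ⧸ AddSubgroup.zmultiples z) = QuotientAddGroup.mk ((i : ZMod n), j) := hx
    obtain ⟨y, hy⟩ := AddSubgroup.mem_zmultiples_iff.mp (QuotientAddGroup.eq_iff_sub_mem.mp hx')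
    have h1 := congrArg Prod.fst hy
    have h2 := congrArg Prod.snd hy
    simp only [hz, Prod.smul_mk, smul_zero, Prod.fst_sub, Prod.snd_sub, smul_eq_mul,
      zsmul_eq_mul] at h1 h2
    refine ⟨x, (ZMod.intCast_zmod_eq_zero_iff_dvd _ n).mp ?_, ?_⟩
    · push_cast
      exact h1.symm
    · have : (n : ℤ) ∣ N := by exact_mod_cast hnN
      simpa [← h2] using this.mul_left y
  have hNv : N • π (0, 1) = 0 := by
    rw [← map_nsmul]
    change QuotientAddGroup.mk' _ (QuotientAddGroup.mk' _ _) = _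
    have : QuotientAddGroup.mk' (AddSubgroup.zmultiples z) (N • ((0, 1) : ZMod n × ℤ)) = 0 :=
      (QuotientAddGroup.eq_zero_iff _).mpr (by simp [hz])
    rw [this, map_zero]
  obtain ⟨c, hc⟩ := exists_addOrderOf_add_nsmul_eq hn (u := π (1, 0)) (v := π (0, 1))
    (by rw [← map_nsmul, show n • ((1, 0) : ZMod n × ℤ) = 0 by ext <;> simp, map_zero])
    (isOfFinAddOrder_iff_nsmul_eq_zero.mpr ⟨N, Nat.pos_of_ne_zero hN, hNv⟩) (by
      intro d hu hv
      obtain ⟨x, h₁, h₂⟩ := hπ0 d 0 (by simpa [← map_nsmul] using hu)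
      obtain ⟨y, h₃, h₄⟩ := hπ0 0 d (by simpa [← map_nsmul] using hv)
      rw [sub_zero] at h₂ h₃
      exact_mod_cast Int.dvd_of_rank_one (by exact_mod_cast hn) h₁ h₂ h₃ h₄)
  refine exists_nimber_quotient_prod_int_eq hN hc hNv fun x => ?_
  obtain ⟨⟨i', j⟩, rfl⟩ := hπ x
  obtain ⟨i, rfl⟩ := ZMod.intCast_surjective i'
  refine ⟨i, j - i * c, ?_⟩
  rw [← map_nsmul, ← map_add, ← map_zsmul π, ← map_zsmul π, ← map_add]
  congr 1
  ext <;> simp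

/-- Every natural number is the nimber of a finite option of `ZMod n × ℤ`. -/
theorem exists_nimber_quotient_prod_int_eq_natCast {n : ℕ} (hn : n ≠ 0) (k : ℕ) :
    ∃ g : ZMod n × ℤ, g.2 ≠ 0 ∧
      nimber ((ZMod n × ℤ) ⧸ AddSubgroup.zmultiples g) = (k : Ordinal.{0}) := by
  induction k using Nat.strong_induction_on with
  | _ k ih =>
    by_contra! hk
    choose g hg hgval using ih
    -- the factor `2` makes the elements `g i` nonzero modulo `(0, N)`
    set N : ℕ := 2 * n * ∏ i : Fin k, (g i i.2).2.natAbs with hN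
    have hN0 : N ≠ 0 := by
      simp only [hN, ne_eq, mul_eq_zero, not_or]
      exact ⟨⟨two_ne_zero, hn⟩, Finset.prod_ne_zero_iff.mpr fun i _ => Int.natAbs_ne_zero.mpr (hg i i.2)⟩
    have hval (i : ℕ) (hi : i < k) : ∃ t : ℤ, (N : ℤ) = 2 * n * t * (g i hi).2 := by
      have h1 : ((g i hi).2.natAbs : ℤ) ∣ ((∏ i : Fin k, (g i i.2).2.natAbs : ℕ) : ℤ) :=
        Int.natCast_dvd_natCast.mpr
          (Finset.dvd_prod_of_mem (fun i : Fin k => (g i i.2).2.natAbs) (Finset.mem_univ ⟨i, hi⟩))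
      obtain ⟨t, ht⟩ := Int.natAbs_dvd.mp h1
      refine ⟨t, ?_⟩
      rw [hN]
      push_cast at ht ⊢
      rw [ht]
      ring
    set z : ZMod n × ℤ := (0, (N : ℤ)) with hz
    -- `z` is a move to a group of nimber `k`
    refine hk z (by simpa [hz] using hN0) (nimber_eq_of_forall (fun h _ => ?_) fun γ hγ => ?_)
    · obtain ⟨g', hg', e⟩ := exists_nimber_quotient_eq_nimber_quotient_quotient hn hN0
        (Dvd.intro_left 2 rfl |>.mul_right _) h
      exact e ▸ hk g' hg'
    · obtain ⟨i, rfl⟩ := Ordinal.lt_omega0.mp (hγ.trans (Ordinal.natCast_lt_omega0 _))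
      have hi : i < k := Nat.cast_lt.mp hγ
      obtain ⟨t, ht⟩ := hval i hi
      refine ⟨QuotientAddGroup.mk (g i hi), fun h0 => ?_, ?_⟩
      · obtain ⟨s, hs⟩ := AddSubgroup.mem_zmultiples_iff.mp ((QuotientAddGroup.eq_zero_iff _).mp h0)
        have h2 : s * N = (g i hi).2 := congrArg Prod.snd hs
        rw [ht] at h2
        have h3 : 2 * (s * n * t) = 1 := mul_right_cancel₀ (hg i hi) (by linear_combination h2)
        omega
      · have hzg : z ∈ AddSubgroup.zmultiples (g i hi) := by
          rw [AddSubgroup.mem_zmultiples_iff]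
          refine ⟨2 * n * t, Prod.ext ?_ ?_⟩
          · simp [hz]
          · rw [hz, ht]
            simp
        rw [← hgval i hi]
        exact nimber_quotient_quotient_mk hzg

/-! ### The nimber of `ZMod n × ℤ` -/

theorem finite_quotient_zmod_prod_int {n : ℕ} (hn : n ≠ 0) {g : ZMod n × ℤ} (hg : g.2 ≠ 0) :
    Finite ((ZMod n × ℤ) ⧸ AddSubgroup.zmultiples g) := by
  refine AddCommGroup.finite_of_fg_isAddTorsion _ fun x => ?_
  obtain ⟨x, rfl⟩ := QuotientAddGroup.mk_surjective x
  refine isOfFinAddOrder_iff_zsmul_eq_zero.mpr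
    ⟨n * g.2, mul_ne_zero (by exact_mod_cast hn) hg, ?_⟩
  have h : (n * g.2) • x = (n * x.2) • g := by
    ext
    · simp
    · simp only [Prod.smul_snd, smul_eq_mul]
      ring
  exact (QuotientAddGroup.eq_zero_iff ((n * g.2) • x)).mpr
    (h ▸ AddSubgroup.zsmul_mem_zmultiples g _)

open ArithmeticFunction in
theorem nimber_zmod_prod_int {n : ℕ} (hn : n ≠ 0) : nimber (ZMod n × ℤ) =
    Ordinal.omega0.{0} + (cardFactors n : Ordinal.{0}) := by
  induction n using Nat.strong_induction_on with
  | _ n ih =>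
    have : NeZero n := ⟨hn⟩
    have hfree (a : ZMod n) (ha : a ≠ 0) :
        nimber ((ZMod n × ℤ) ⧸ AddSubgroup.zmultiples ((a, 0) : ZMod n × ℤ)) =
          Ordinal.omega0.{0} +
            (cardFactors (Nat.card (ZMod n ⧸ AddSubgroup.zmultiples a)) : Ordinal.{0}) := by
      have hlt := AddSubgroup.card_quotient_zmultiples_lt ha
      rw [Nat.card_zmod] at hlt
      have : IsAddCyclic (ZMod n ⧸ AddSubgroup.zmultiples a) :=
        isAddCyclic_of_surjective (QuotientAddGroup.mk' _) (QuotientAddGroup.mk'_surjective _)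
      rw [← ih _ hlt Nat.card_pos.ne']
      let e := (zmodAddCyclicAddEquiv (G := ZMod n ⧸ AddSubgroup.zmultiples a) inferInstance).symm
      refine nimber_quotient_zmultiples_eq
        ((e.toAddMonoidHom.comp (QuotientAddGroup.mk' _)).prodMap (AddMonoidHom.id ℤ))
        (Function.Surjective.prodMap (e.surjective.comp (QuotientAddGroup.mk'_surjective _))
          Function.surjective_id) _ ?_
      rintro ⟨x, y⟩
      simp [Prod.ext_iff, AddSubgroup.mem_zmultiples_iff, eq_comm (a := y)]
    have hfin (g : ZMod n × ℤ) (hg : g.2 ≠ 0) :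
        nimber ((ZMod n × ℤ) ⧸ AddSubgroup.zmultiples g) < Ordinal.omega0.{0} :=
      have := finite_quotient_zmod_prod_int hn hg
      nimber_lt_omega0_of_finite _
    refine nimber_eq_of_forall (fun g hg => ?_) fun γ hγ => ?_
    · by_cases h0 : g.2 = 0
      · obtain ⟨a, b⟩ := g
        obtain rfl : b = 0 := h0
        have ha : a ≠ 0 := fun h => hg (by rw [h]; rfl)
        have hlt := cardFactors_card_quotient_zmultiples_lt ha
        rw [Nat.card_zmod] at hlt
        rw [hfree a ha, Ne, add_right_inj, Nat.cast_inj]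
        exact hlt.ne
      · exact ((hfin g h0).trans_le le_self_add).ne
    · rcases lt_or_ge γ Ordinal.omega0.{0} with h | h
      · obtain ⟨k, rfl⟩ := Ordinal.lt_omega0.mp h
        obtain ⟨g, hg, e⟩ := exists_nimber_quotient_prod_int_eq_natCast hn k
        exact ⟨g, fun h => hg (by rw [h]; rfl), e⟩
      · obtain ⟨δ, rfl⟩ := exists_add_of_le h
        rw [add_lt_add_iff_left] at hγ
        obtain ⟨j, rfl⟩ := Ordinal.lt_omega0.mp (hγ.trans (Ordinal.natCast_lt_omega0 _))
        obtain ⟨a, ha, e⟩ := exists_cardFactors_card_quotient_zmultiples_eq (A := ZMod n) (j := j)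
          (by rw [Nat.card_zmod]; exact Nat.cast_lt.mp hγ)
        refine ⟨(a, 0), fun h => ha (congrArg Prod.fst h), ?_⟩
        rw [hfree a ha, e]

theorem theorem1p2 :
    (∀ n : ℕ, 1 ≤ n → nimber (ZMod n) = (ArithmeticFunction.cardFactors n : Ordinal.{0})) ∧
    nimber ℤ = Ordinal.omega0.{0} ∧
    (∀ n : ℕ, 1 ≤ n →
      nimber (ZMod n × ℤ) =
        Ordinal.omega0.{0} + (ArithmeticFunction.cardFactors n : Ordinal.{0})) := by
  refine ⟨fun n hn => ?_, ?_, fun n hn => nimber_zmod_prod_int (by omega)⟩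
  · have : NeZero n := ⟨by omega⟩
    rw [nimber_eq_cardFactors_card, Nat.card_zmod]
  · rw [nimber_congr (AddEquiv.uniqueProd (M := ℤ) (N := ZMod 1)).symm,
      nimber_zmod_prod_int one_ne_zero]
    simp
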